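/- Let $\mathbb K$ be an algebraically closed field of characteristic zero, $T=(\mathbb K^\times)^n$ an algebraic torus, and $X$ an affine toric variety over $\mathbb K$, that is, an irreducible affine variety with an algebraic action of $T$ that has an open orbit; $X$ need not be normal. Grade the algebra of regular functions $\mathbb K[X]$ by the character group $\mathfrak X(T)\cong\mathbb Z^n$, the component of degree $m$ being the space of $T$-semi-invariants of weight $\chi^m$. A $\mathbb K$-derivation $D$ of $\mathbb K[X]$ is called locally nilpotent (an LND) if for each $f\in\mathbb K[X]$ there is a $k\ge 1$ with $D^k(f)=0$; a slice of $D$ is an element $s\in\mathbb K[X]$ with $D(s)=1$; and $D$ is called homogeneous if there is an $e\in\mathfrak X(T)$ such that $D(\mathbb K[X]_m)\subseteq\mathbb K[X]_{m+e}$ for all $m\in\mathfrak X(T)$. Let $\mathrm{ML}(\mathbb K[X])$, $\mathrm{ML}_h(\mathbb K[X])$ and $\mathrm{ML}^*(\mathbb K[X])$ be the intersections of the kernels of, respectively, all LNDs, all homogeneous LNDs, and all LNDs with a slice of $\mathbb K[X]$. Then: (a) $\mathrm{ML}_h(\mathbb K[X])=\mathrm{ML}(\mathbb K[X])$; (b)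 if $\mathbb K[X]$ admits an LND with a slice, then $\mathrm{ML}_h(\mathbb K[X])=\mathrm{ML}(\mathbb K[X])=\mathrm{ML}^*(\mathbb K[X])$. -/

import Mathlib

open scoped TensorProduct

noncomputable section

namespace AffineToric

section Derivations

variable (K : Type*) (B : Type*) [Field K] [CommRing B] [Algebra K B]

/-- The kernel of a `K`-derivation of `B`, as a `K`-subalgebra of `B`. -/
def ker {K B : Type*} [Field K] [CommRing B] [Algebra K B] (D : Derivation K B B) :
    Subalgebra K B where
  carrier := {b | D b = 0}
  mul_mem' := by
    intro a b ha hb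
    change D a = 0 at ha
    change D b = 0 at hb
    change D (a * b) = 0
    simp [ha, hb]
  add_mem' := by
    intro a b ha hb
    change D a = 0 at ha
    change D b = 0 at hb
    change D (a + b) = 0
    simp [ha, hb]
  algebraMap_mem' := by
    intro r
    simp

/-- The set of locally nilpotent `K`-derivations of `B`. -/
def LND : Set (Derivation K B B) :=
  {D | ∀ b : B, ∃ k : ℕ, (fun c : B => D c)^[k] b = 0}

/-- The set of locally nilpotent `K`-derivations of `B` that have a slice. -/
def LNDStar : Set (Derivation K B B) :=
  {D | D ∈ LND K B ∧ ∃ s : B, D s = 1}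

/-- The Makar-Limanov invariant. -/
def ML : Subalgebra K B := ⨅ D ∈ LND K B, ker D

/-- The Makar-Limanov--Freudenburg invariant. -/
def MLStar : Subalgebra K B := ⨅ D ∈ LNDStar K B, ker D

end Derivations

section Torus

variable (K : Type*) [Field K] (n : ℕ)

/-- The (points of the) algebraic torus `(Kˣ)ⁿ`. -/
abbrev Torus : Type _ := Fin n → Kˣ

/-- The coordinate algebra of the torus `(Kˣ)ⁿ`: the Laurent polynomials in `n` variables. -/
abbrev TorusAlgebra : Type _ := AddMonoidAlgebra K (Fin n → ℤ)

variable {K n}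

/-- The value `χ^m(t) = t₁^{m₁} ⋯ tₙ^{mₙ}` of the character `χ^m` at the point `t`. The map
`m ↦ χ^m` identifies `ℤⁿ` with the character group of the torus. -/
def character (m : Fin n → ℤ) (t : Torus K n) : Kˣ := ∏ i, t i ^ m i

/-- Evaluation of Laurent polynomials at the point `t` of the torus. -/
def evalAt (t : Torus K n) : TorusAlgebra K n →ₐ[K] K :=
  AddMonoidAlgebra.lift K K (Fin n → ℤ)
    { toFun := fun m => ((character m.toAdd t : Kˣ) : K)
      map_one' := by simp [character]
      map_mul' := by
        intro a b
        simp [character, zpow_add, Finset.prod_mul_distrib] }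

theorem evalAt_single (t : Torus K n) (m : Fin n → ℤ) (a : K) :
    evalAt t (AddMonoidAlgebra.single m a) = a * (character m t : K) := by
  simp [evalAt, AddMonoidAlgebra.lift_single]

end Torus

/-- The structure of a toric variety, with respect to the torus `T = (Kˣ)ⁿ`, on the affine
variety `X` with coordinate algebra `K[X] = B`: an algebraic action of `T` on `X` with an open
orbit. Neither normality of `X` nor effectiveness of the action is required. -/
structure ToricStructure (K : Type*) [Field K] (n : ℕ) (B : Type*) [CommRing B]
    [Algebra K B] where
  /-- The action on functions, `(pullback t f)(x) = f (t • x)`. -/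
  pullback : Torus K n →* (B ≃ₐ[K] B)
  /-- The action is algebraic: it is given by a morphism of varieties `X × T → X`, i.e. by a
  homomorphism `K[X] → K[X × T] = K[X] ⊗ K[T]`, and `pullback t` is obtained from it by
  evaluating the second factor at `t`. -/
  algebraic : ∃ φ : B →ₐ[K] B ⊗[K] TorusAlgebra K n, ∀ (t : Torus K n) (f : B),
    pullback t f =
      Algebra.TensorProduct.rid K K B
        (Algebra.TensorProduct.map (AlgHom.id K B) (evalAt t) (φ f))
  /-- There is a point `x` of `X` whose orbit is Zariski open. Points of `X` are maximal ideals
  of `K[X]`; the ideal of the point `t • x` consists of the `f` such that `pullback t f` vanishes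
  at `x`. -/
  open_orbit : ∃ x : MaximalSpectrum B,
    IsOpen {y : MaximalSpectrum B |
      ∃ t : Torus K n, y.asIdeal = x.asIdeal.comap (pullback t : B →+* B)}

namespace ToricStructure

variable {K : Type*} [Field K] {n : ℕ} {B : Type*} [CommRing B] [Algebra K B]

/-- The homogeneous component of degree `m` of `K[X]`, in the grading by the character group of
the torus: the functions that are semi-invariant of weight `χ^m`. -/
def weightSpace (X : ToricStructure K n B) (m : Fin n → ℤ) : Submodule K B where
  carrier := {f | ∀ t : Torus K n, X.pullback t f = (character m t : K) • f}
  add_mem' := by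
    intro a b ha hb t
    simp [ha t, hb t]
  zero_mem' := by
    intro t
    simp
  smul_mem' := by
    intro c a ha t
    rw [map_smul, ha t, smul_comm]

/-- A derivation is homogeneous if it shifts all degrees by one and the same `e`. -/
def IsHomogeneous (X : ToricStructure K n B) (D : Derivation K B B) : Prop :=
  ∃ e : Fin n → ℤ, ∀ m : Fin n → ℤ, ∀ f ∈ X.weightSpace m, D f ∈ X.weightSpace (m + e)

/-- The set of homogeneous locally nilpotent derivations of `K[X]`. -/
def LNDh (X : ToricStructure K n B) : Set (Derivation K B B) :=
  {D | D ∈ LND K B ∧ X.IsHomogeneous D}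

/-- The homogeneous Makar-Limanov invariant. -/
def MLh (X : ToricStructure K n B) : Subalgebra K B := ⨅ D ∈ X.LNDh, ker D

end ToricStructure

end AffineToric

end

/-!
The translates of a function under the torus are combinations of characters, so `K[X]` is the direct
sum of its weight spaces. Evaluation at a point of the open orbit is injective on each weight space,
so all weight spaces have dimension at most one
(`ToricStructure.isMultiplicityFree_weightSpace`). Linear independence of characters reduces both
claims to semi-invariant functions. The rest holds in every Noetherian domain of characteristic zero
with such a grading and needs no convex geometry.

*Homogeneous derivations.* If `D` is homogeneous of degree `e` and no `N • e` with `N > 0` is the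
degree of a nonzero function, then `D` is locally nilpotent, because a sequence `f, D f, D² f, …` of
nonzero elements would contradict Noetherianity (`IsHomogeneousOfDegree.mem_LND`).

*Homogeneous versus all derivations.* Let `D` be a locally nilpotent derivation and `f` homogeneous
with `D f ≠ 0`. If every homogeneous part `D_e` with `D_e f ≠ 0` had a degree `e` with some
`N • e`, `N > 0`, the degree of a nonzero function, then `(D_e f / f)^N` would lie in `K[X]`. Hence
`D f / f` would be integral over `K[X]` and its powers would have a common denominator `f ^ M`. This
is impossible, since the degree function of `D` is additive on products and gives `D f / f` the
degree `-1` (`apply_eq_zero_of_pow_dvd`). So some `D_e` with `D_e f ≠ 0` is locally nilpotent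
(`exists_homogeneousPart_mem_LND`).

*Derivations with a slice.* If there is one, then a homogeneous part of it, suitably scaled, is a
homogeneous locally nilpotent derivation `δ` with a homogeneous slice `y`
(`exists_homogeneous_slice`). Let `E` be a homogeneous locally nilpotent derivation that does not
kill a homogeneous `f` with `δ f = 0`. Comparing degrees with respect to `δ` shows that `E y` would
be divisible by `y`, so `E y = 0`. Then `δ + E` is locally nilpotent with slice `y`
(`add_mem_LND`), and it does not kill `f` (`apply_eq_zero_of_mem_MLStar`).
-/

open scoped TensorProduct

noncomputable section

namespace AffineToric

/-! ### The degree function of a locally nilpotent derivation -/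

section Degree

variable {K B : Type*} [Field K] [CommRing B] [Algebra K B]

theorem iterate_mul_of_eq_zero (D : Derivation K B B) {a : B} (ha : D a = 0) (b : B) (k : ℕ) :
    D^[k] (a * b) = a * D^[k] b := by
  induction k generalizing b with
  | zero => rfl
  | succ k ih => simp [Function.iterate_succ_apply, ha, ih]

theorem iterate_zero_right (D : Derivation K B B) (k : ℕ) : D^[k] 0 = 0 :=
  iterate_map_zero D k

/-- The extreme term of the Leibniz formula for the iterates of a derivation. -/
theorem iterate_add_mul (D : Derivation K B B) {i j : ℕ} {a b : B}
    (ha : D^[i + 1] a = 0) (hb : D^[j + 1] b = 0) :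
    D^[i + j] (a * b) = (i + j).choose i • (D^[i] a * D^[j] b) := by
  obtain ⟨N, hN⟩ : ∃ N, i + j = N := ⟨_, rfl⟩
  induction N generalizing i j a b with
  | zero =>
    obtain ⟨rfl, rfl⟩ : i = 0 ∧ j = 0 := by omega
    simp
  | succ N ih =>
    rcases i with _ | i
    · simp [iterate_mul_of_eq_zero D (show D a = 0 from ha)]
    rcases j with _ | j
    · rw [mul_comm a, Nat.add_zero, iterate_mul_of_eq_zero D (show D b = 0 from hb), mul_comm b,
        Nat.choose_self, one_smul]
      rfl
    have h1 := ih (i := i) (j := j + 1) (a := D a) (b := b) ha hb (by omega)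
    have h2 := ih (i := i + 1) (j := j) (a := a) (b := D b) ha hb (by omega)
    have e : i + 1 + (j + 1) = (i + (j + 1)) + 1 := by omega
    have e' : i + 1 + j = i + (j + 1) := by omega
    rw [e'] at h2
    rw [e, Function.iterate_succ_apply, Derivation.leibniz, iterate_map_add, smul_eq_mul,
      smul_eq_mul, mul_comm b, h1, h2, Nat.choose_succ_succ, add_smul, add_comm]
    rfl

/-- `b` has degree `k` with respect to the derivation `D`: applying `D` exactly `k` times to `b`
gives a nonzero element of the kernel of `D`. -/
def HasDegree (D : Derivation K B B) (b : B) (k : ℕ) : Prop :=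
  D^[k] b ≠ 0 ∧ D^[k + 1] b = 0

theorem exists_hasDegree {D : Derivation K B B} (hD : D ∈ LND K B) {b : B} (hb : b ≠ 0) :
    ∃ k, HasDegree D b k := by
  classical
  have h : ∃ k, D^[k] b = 0 := hD b
  obtain ⟨k, hk⟩ : ∃ k, Nat.find h = k + 1 :=
    Nat.exists_eq_succ_of_ne_zero fun h0 => hb (by simpa [h0] using Nat.find_spec h)
  exact ⟨k, Nat.find_min h (by omega), hk ▸ Nat.find_spec h⟩

theorem HasDegree.ne_zero {D : Derivation K B B} {b : B} {k : ℕ} (h : HasDegree D b k) :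
    b ≠ 0 := by
  rintro rfl
  exact h.1 (iterate_zero_right D k)

theorem HasDegree.unique {D : Derivation K B B} {b : B} {k l : ℕ} (hk : HasDegree D b k)
    (hl : HasDegree D b l) : k = l := by
  have key : ∀ {k l : ℕ}, HasDegree D b k → HasDegree D b l → ¬ k < l := by
    intro k l hk hl h
    obtain ⟨d, rfl⟩ := Nat.exists_eq_add_of_lt h
    apply hl.1
    rw [show k + d + 1 = d + (k + 1) by omega, Function.iterate_add_apply, hk.2,
      iterate_zero_right]
  exact le_antisymm (not_lt.1 (key hl hk)) (not_lt.1 (key hk hl))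

theorem HasDegree.of_apply {D : Derivation K B B} {b : B} {k : ℕ} (h : HasDegree D (D b) k) :
    HasDegree D b (k + 1) :=
  h

theorem hasDegree_zero {D : Derivation K B B} {b : B} (hb : b ≠ 0) (h : D b = 0) :
    HasDegree D b 0 :=
  ⟨hb, h⟩

variable [IsDomain B] [CharZero K]

theorem HasDegree.mul {D : Derivation K B B} {a b : B} {i j : ℕ} (ha : HasDegree D a i)
    (hb : HasDegree D b j) : HasDegree D (a * b) (i + j) := by
  have : CharZero B := charZero_of_injective_algebraMap (algebraMap K B).injective
  have h := iterate_add_mul D ha.2 hb.2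
  refine ⟨?_, ?_⟩
  · rw [h, nsmul_eq_mul]
    exact mul_ne_zero (Nat.cast_ne_zero.2 (Nat.choose_pos (by omega)).ne')
      (mul_ne_zero ha.1 hb.1)
  · have h1 : D (D^[i] a) = 0 := by simpa only [Function.iterate_succ_apply'] using ha.2
    have h2 : D (D^[j] b) = 0 := by simpa only [Function.iterate_succ_apply'] using hb.2
    rw [Function.iterate_succ_apply', h, map_nsmul, Derivation.leibniz, h1, h2]
    simp

theorem HasDegree.pow {D : Derivation K B B} {a : B} {i : ℕ} (ha : HasDegree D a i) (k : ℕ) :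
    HasDegree D (a ^ k) (k * i) := by
  induction k with
  | zero => simpa using hasDegree_zero (D := D) (pow_ne_zero 0 ha.ne_zero) (by simp)
  | succ k ih => simpa [pow_succ, add_mul] using ih.mul ha

/-- The degree of an element is at least the degree of each of its factors, and a locally nilpotent
derivation lowers degrees by one; so the fraction `D f / f` of degree `-1` cannot have powers with
a common denominator. -/
theorem apply_eq_zero_of_pow_dvd {D : Derivation K B B} (hD : D ∈ LND K B) {f : B} (M : ℕ)
    (h : ∀ k, f ^ k ∣ f ^ M * D f ^ k) : D f = 0 := by
  by_contra h0
  have hf : f ≠ 0 := by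
    rintro rfl
    exact h0 (map_zero D)
  obtain ⟨d, hd⟩ := exists_hasDegree hD h0
  have hfd := hd.of_apply
  obtain ⟨c, hc⟩ := h (M * (d + 1) + 1)
  have hr := (hfd.pow M).mul (hd.pow (M * (d + 1) + 1))
  have hc0 : c ≠ 0 := by
    rintro rfl
    exact hr.ne_zero (by simpa using hc)
  obtain ⟨l, hl⟩ := exists_hasDegree hD hc0
  have hs := (hfd.pow (M * (d + 1) + 1)).mul hl
  rw [← hc] at hs
  have := hs.unique hr
  nlinarith

theorem apply_eq_zero_of_dvd {D : Derivation K B B} (hD : D ∈ LND K B) {f : B}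
    (h : f ∣ D f) : D f = 0 :=
  apply_eq_zero_of_pow_dvd hD 0 fun k => by simpa using pow_dvd_pow_of_dvd h k

end Degree

/-! ### Fractions whose powers have a common denominator -/

section Fractions

variable {B : Type*} [CommRing B]

/-- The hypotheses say that `f ^ M` and `f ^ M'` are common denominators for the powers of `g / f`
and of `g' / f`; then their product is one for the powers of `(g + g') / f`. -/
theorem pow_dvd_pow_mul_add_pow {f g g' : B} {M M' : ℕ} (h : ∀ k, f ^ k ∣ f ^ M * g ^ k)
    (h' : ∀ k, f ^ k ∣ f ^ M' * g' ^ k) (k : ℕ) : f ^ k ∣ f ^ (M + M') * (g + g') ^ k := by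
  rw [add_pow, Finset.mul_sum]
  refine Finset.dvd_sum fun i hi => ?_
  have hk : f ^ k = f ^ i * f ^ (k - i) := by
    rw [← pow_add]
    congr 1
    have := Finset.mem_range.1 hi
    omega
  rw [hk, show f ^ (M + M') * (g ^ i * g' ^ (k - i) * (k.choose i : B)) =
    (f ^ M * g ^ i) * (f ^ M' * g' ^ (k - i)) * (k.choose i : B) by ring]
  exact Dvd.dvd.mul_right (mul_dvd_mul (h i) (h' (k - i))) _

theorem exists_pow_dvd_pow_mul_sum_pow {ι : Type*} (s : Finset ι) {f : B} {g : ι → B}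
    (h : ∀ i ∈ s, ∃ M : ℕ, ∀ k, f ^ k ∣ f ^ M * g i ^ k) :
    ∃ M : ℕ, ∀ k, f ^ k ∣ f ^ M * (∑ i ∈ s, g i) ^ k := by
  classical
  induction s using Finset.induction_on with
  | empty =>
    refine ⟨1, fun k => ?_⟩
    rcases k with _ | k <;> simp
  | insert a s ha ih =>
    obtain ⟨M, hM⟩ := h a (Finset.mem_insert_self a s)
    obtain ⟨M', hM'⟩ := ih fun i hi => h i (Finset.mem_insert_of_mem hi)
    exact ⟨M + M', by simpa [Finset.sum_insert ha] using pow_dvd_pow_mul_add_pow hM hM'⟩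

/-- If `(g / f) ^ N` lies in `B`, then `f ^ N` is a common denominator for the powers of `g / f`. -/
theorem pow_dvd_pow_mul_pow {f g w : B} {N : ℕ} (hN : 0 < N) (h : g ^ N = w * f ^ N) (k : ℕ) :
    f ^ k ∣ f ^ N * g ^ k := by
  have hk := Nat.div_add_mod k N
  have hlt := Nat.mod_lt k hN
  set q := k / N
  set r := k % N
  have : f ^ N * g ^ k = f ^ (N + N * q) * (w ^ q * g ^ r) := by
    rw [← hk, pow_add g, pow_mul g, h, mul_pow, ← pow_mul, pow_add]
    ring
  rw [this]
  exact Dvd.dvd.mul_right (pow_dvd_pow f (by omega)) _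

end Fractions

/-! ### Derivations of graded algebras -/

section Graded

variable {K B ι : Type*} [Field K] [CommRing B] [Algebra K B] [AddCommGroup ι]
  {𝒜 : ι → Submodule K B}

/-- The derivation `D` shifts all degrees by `e`. -/
def IsHomogeneousOfDegree (𝒜 : ι → Submodule K B) (D : Derivation K B B) (e : ι) : Prop :=
  ∀ m, ∀ f ∈ 𝒜 m, D f ∈ 𝒜 (m + e)

theorem IsHomogeneousOfDegree.iterate_mem {D : Derivation K B B} {e : ι}
    (hD : IsHomogeneousOfDegree 𝒜 D e) {m : ι} {f : B} (hf : f ∈ 𝒜 m) (k : ℕ) :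
    D^[k] f ∈ 𝒜 (m + k • e) := by
  induction k with
  | zero => simpa using hf
  | succ k ih =>
    rw [Function.iterate_succ_apply', succ_nsmul, ← add_assoc]
    exact hD _ _ ih

variable [DecidableEq ι] [GradedAlgebra 𝒜]

/-- Local nilpotency may be tested on homogeneous elements. -/
theorem mem_LND_of_homogeneous (𝒜 : ι → Submodule K B) [GradedAlgebra 𝒜] {D : Derivation K B B}
    (h : ∀ m, ∀ f ∈ 𝒜 m, ∃ k : ℕ, D^[k] f = 0) : D ∈ LND K B := by
  intro b
  change ∃ k : ℕ, D^[k] b = 0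
  induction b using DirectSum.Decomposition.inductionOn 𝒜 with
  | zero => exact ⟨0, rfl⟩
  | homogeneous f => exact h _ _ f.2
  | add a b ha hb =>
    obtain ⟨k, hk⟩ := ha
    obtain ⟨l, hl⟩ := hb
    refine ⟨k + l, ?_⟩
    rw [iterate_map_add, Function.iterate_add_apply D k l b, hl, iterate_zero_right, add_comm k l,
      Function.iterate_add_apply, hk, iterate_zero_right, add_zero]

/-- A homogeneous derivation of degree `e` is locally nilpotent as soon as no positive multiple
of `e` is the degree of a nonzero element: otherwise the elements `f, D f, D² f, …` would generate
a strictly increasing chain of ideals. -/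
theorem IsHomogeneousOfDegree.mem_LND [IsNoetherianRing B] {D : Derivation K B B} {e : ι}
    (hD : IsHomogeneousOfDegree 𝒜 D e) (he : ∀ N : ℕ, 0 < N → 𝒜 (N • e) = ⊥) :
    D ∈ LND K B := by
  refine mem_LND_of_homogeneous 𝒜 fun m f hf => ?_
  let I : ℕ →o Ideal B :=
    ⟨fun n => Ideal.span ((fun i => D^[i] f) '' Set.Iio n), fun a b hab =>
      Ideal.span_mono (Set.image_mono (Set.Iio_subset_Iio hab))⟩
  obtain ⟨n, hn⟩ := monotone_stabilizes_iff_noetherian.2 (inferInstance : IsNoetherian B B) I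
  have hmem : D^[n] f ∈ I n := by
    rw [hn (n + 1) n.le_succ]
    exact Ideal.subset_span ⟨n, Nat.lt_succ_self n, rfl⟩
  have key : ∀ x ∈ I n, GradedAlgebra.proj 𝒜 (m + n • e) x = 0 := by
    intro x hx
    induction hx using Submodule.closure_induction with
    | zero => exact map_zero _
    | add x y _ _ hx hy => rw [map_add, hx, hy, add_zero]
    | smul_mem a x hx =>
      obtain ⟨i, hi, rfl⟩ := hx
      have hi : i < n := hi
      obtain ⟨j, rfl⟩ := Nat.exists_eq_add_of_lt hi
      have h0 : GradedAlgebra.proj 𝒜 ((j + 1) • e) a = 0 := by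
        rw [← Submodule.mem_bot (R := K), ← he (j + 1) j.succ_pos, GradedAlgebra.proj_apply]
        exact SetLike.coe_mem _
      rw [GradedAlgebra.proj_apply] at h0
      rw [GradedAlgebra.proj_apply, show m + (i + j + 1) • e = (j + 1) • e + (m + i • e) by
        rw [add_assoc i, add_nsmul]; abel, smul_eq_mul,
        DirectSum.coe_decompose_mul_add_of_right_mem 𝒜 (hD.iterate_mem hf i), h0, zero_mul]
  refine ⟨n, ?_⟩
  rw [← key _ hmem, GradedAlgebra.proj_apply,
    DirectSum.decompose_of_mem_same 𝒜 (hD.iterate_mem hf n)]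

/-- The homogeneous part of degree `e` of a linear endomorphism. -/
def homogeneousPartLinear (𝒜 : ι → Submodule K B) [GradedAlgebra 𝒜] (D : B →ₗ[K] B) (e : ι) :
    B →ₗ[K] B :=
  DirectSum.toModule K ι B
      (fun p => GradedAlgebra.proj 𝒜 (p + e) ∘ₗ D ∘ₗ (𝒜 p).subtype) ∘ₗ
    (DirectSum.decomposeLinearEquiv 𝒜).toLinearMap

theorem homogeneousPartLinear_apply (D : B →ₗ[K] B) (e : ι) {p : ι} {f : B} (hf : f ∈ 𝒜 p) :
    homogeneousPartLinear 𝒜 D e f = GradedAlgebra.proj 𝒜 (p + e) (D f) := by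
  lift f to 𝒜 p using hf
  simp only [homogeneousPartLinear, LinearMap.comp_apply, LinearEquiv.coe_coe,
    DirectSum.decomposeLinearEquiv_apply_coe, DirectSum.toModule_lof]
  rfl

/-- The homogeneous part of degree `e` of a derivation of a graded algebra: it sends `f` of degree
`p` to the component of degree `p + e` of `D f`. -/
def homogeneousPart (𝒜 : ι → Submodule K B) [GradedAlgebra 𝒜] (D : Derivation K B B) (e : ι) :
    Derivation K B B :=
  Derivation.mk' (homogeneousPartLinear 𝒜 D.toLinearMap e) fun a b => by
    induction a using DirectSum.Decomposition.inductionOn 𝒜 with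
    | zero => simp
    | add a a' ha ha' => rw [add_mul, map_add, ha, ha', map_add]; simp only [smul_eq_mul]; ring
    | @homogeneous p a =>
      induction b using DirectSum.Decomposition.inductionOn 𝒜 with
      | zero => simp
      | add b b' hb hb' => rw [mul_add, map_add, hb, hb', map_add]; simp only [smul_eq_mul]; ring
      | @homogeneous q b =>
        rw [homogeneousPartLinear_apply _ _ a.2, homogeneousPartLinear_apply _ _ b.2,
          homogeneousPartLinear_apply _ _ (SetLike.mul_mem_graded a.2 b.2)]
        simp only [Derivation.coeFn_coe, Derivation.leibniz,
          map_add, smul_eq_mul, GradedAlgebra.proj_apply]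
        rw [show p + q + e = p + (q + e) by abel,
          DirectSum.coe_decompose_mul_add_of_left_mem 𝒜 a.2,
          show p + (q + e) = q + (p + e) by abel,
          DirectSum.coe_decompose_mul_add_of_left_mem 𝒜 b.2]

theorem homogeneousPart_apply (D : Derivation K B B) (e : ι) {p : ι} {f : B} (hf : f ∈ 𝒜 p) :
    homogeneousPart 𝒜 D e f = GradedAlgebra.proj 𝒜 (p + e) (D f) :=
  homogeneousPartLinear_apply D.toLinearMap e hf

theorem isHomogeneousOfDegree_homogeneousPart (D : Derivation K B B) (e : ι) :
    IsHomogeneousOfDegree 𝒜 (homogeneousPart 𝒜 D e) e := by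
  intro p f hf
  rw [homogeneousPart_apply D e hf, GradedAlgebra.proj_apply]
  exact SetLike.coe_mem _

end Graded

/-! ### Multiplicity-free gradings -/

section MultiplicityFree

variable {K B ι : Type*} [Field K] [CommRing B] [Algebra K B] [AddCommGroup ι] [DecidableEq ι]

/-- All components of the grading have dimension at most one. -/
def IsMultiplicityFree (𝒜 : ι → Submodule K B) : Prop :=
  ∀ m, ∀ f ∈ 𝒜 m, ∀ g ∈ 𝒜 m, g ≠ 0 → ∃ c : K, f = c • g

variable [IsDomain B] {𝒜 : ι → Submodule K B} [GradedAlgebra 𝒜]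

/-- The sum of `δ` and a homogeneous locally nilpotent derivation that kills a homogeneous slice
`y` of `δ` is locally nilpotent: for `b` homogeneous, `y * δ b` is a scalar multiple of `b`, so `δ`
does not raise the degree with respect to `E`, while `E` lowers it. -/
theorem add_mem_LND (h𝒜 : IsMultiplicityFree 𝒜) {δ E : Derivation K B B}
    (hδ : δ ∈ LND K B) (hE : E ∈ LND K B) {p e : ι} (hδp : IsHomogeneousOfDegree 𝒜 δ (-p))
    (hEe : IsHomogeneousOfDegree 𝒜 E e) {y : B} (hy : y ∈ 𝒜 p) (hδy : δ y = 1) (hEy : E y = 0) :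
    δ + E ∈ LND K B := by
  have hy0 : y ≠ 0 := by
    rintro rfl
    simp at hδy
  -- Lexicographic induction on the degrees with respect to `E` and `δ`: passing from `b` to `δ b`
  -- lowers `j` and keeps `i`, passing to `E b` lowers `i` and may raise `j`.
  have key : ∀ i j : ℕ, ∀ m, ∀ b ∈ 𝒜 m, E^[i] b = 0 → δ^[j] b = 0 →
      ∃ k : ℕ, (δ + E)^[k] b = 0 := by
    intro i
    induction i with
    | zero => exact fun j m b _ hb _ => ⟨0, hb⟩
    | succ i ih =>
      intro j
      induction j with
      | zero => exact fun m b _ _ hb => ⟨0, hb⟩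
      | succ j ihj =>
        intro m b hb hEb hδb
        have hE' : E^[i + 1] (δ b) = 0 := by
          by_cases hb0 : δ b = 0
          · rw [hb0, iterate_zero_right]
          obtain ⟨c, hc⟩ := h𝒜 m (y * δ b) (by
            have := SetLike.mul_mem_graded hy (hδp m b hb)
            rwa [show p + (m + -p) = m by abel] at this) b hb (by
              rintro rfl
              exact hb0 (map_zero δ))
          have h1 := iterate_mul_of_eq_zero E hEy (δ b) (i + 1)
          have h2 : E^[i + 1] (c • b) = c • E^[i + 1] b :=
            Function.Commute.iterate_left (g := fun x : B => c • x) (fun x => E.map_smul c x) _ b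
          rw [hc, h2, hEb, smul_zero] at h1
          exact (mul_eq_zero.1 h1.symm).resolve_left hy0
        obtain ⟨k, hk⟩ := ihj _ _ (hδp m b hb) hE' hδb
        obtain ⟨l, hl⟩ := hδ (E b)
        obtain ⟨l, hl⟩ := ih l _ _ (hEe m b hb) hEb hl
        refine ⟨k + l + 1, ?_⟩
        rw [Function.iterate_succ_apply, Derivation.add_apply, iterate_map_add,
          Function.iterate_add_apply (δ + E) k l (E b), hl, iterate_zero_right, add_comm k l,
          Function.iterate_add_apply, hk, iterate_zero_right, add_zero]
  refine mem_LND_of_homogeneous 𝒜 fun m b hb => ?_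
  obtain ⟨i, hi⟩ := hE b
  obtain ⟨j, hj⟩ := hδ b
  exact key i j m b hb hi hj

variable [CharZero K]

/-- A homogeneous element that is killed by all locally nilpotent derivations with a slice is killed
by all homogeneous locally nilpotent derivations. If `E` is one that does not kill `f`, then `E`
kills the slice `y` of `δ`, so `δ + E` has the slice `y` and does not kill `f`. -/
theorem apply_eq_zero_of_mem_MLStar (h𝒜 : IsMultiplicityFree 𝒜) {δ : Derivation K B B}
    (hδ : δ ∈ LND K B) {p : ι} (hδp : IsHomogeneousOfDegree 𝒜 δ (-p)) {y : B} (hy : y ∈ 𝒜 p)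
    (hδy : δ y = 1) {m : ι} {f : B} (hfm : f ∈ 𝒜 m) (hf : ∀ D ∈ LNDStar K B, D f = 0)
    {E : Derivation K B B} (hE : E ∈ LND K B) {e : ι} (hEe : IsHomogeneousOfDegree 𝒜 E e) :
    E f = 0 := by
  by_contra hEf
  have hf0 : f ≠ 0 := by
    rintro rfl
    exact hEf (map_zero E)
  have hy0 : y ≠ 0 := by
    rintro rfl
    simp at hδy
  have hδf : δ f = 0 := hf δ ⟨hδ, y, hδy⟩
  have hEy : E y = 0 := by
    by_contra hEy
    -- `E y` has positive degree with respect to `δ`, since `E y * f` is a multiple of `y * E f`.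
    have hδE : δ (E y) ≠ 0 := by
      intro h
      obtain ⟨d, hd⟩ := exists_hasDegree hδ hEf
      have h1 : HasDegree δ y 1 := ⟨by simp [hδy], by simp [hδy]⟩
      have h2 : HasDegree δ (y * E f) (1 + d) := h1.mul hd
      obtain ⟨c, hc⟩ := h𝒜 (p + (m + e)) (y * E f) (SetLike.mul_mem_graded hy (hEe _ _ hfm))
        (E y * f) (by
          have := SetLike.mul_mem_graded (hEe _ _ hy) hfm
          rwa [show p + e + m = p + (m + e) by abel] at this) (mul_ne_zero hEy hf0)
      have h3 : δ (y * E f) = 0 := by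
        rw [hc, Derivation.map_smul, Derivation.leibniz, h, hδf]
        simp
      have := h2.unique (hasDegree_zero h2.ne_zero h3)
      omega
    obtain ⟨c, hc⟩ := h𝒜 (p + e) (E y) (hEe _ _ hy) (y * δ (E y)) (by
      have := SetLike.mul_mem_graded hy (hδp _ _ (hEe _ _ hy))
      rwa [show p + (p + e + -p) = p + e by abel] at this) (mul_ne_zero hy0 hδE)
    exact hEy (apply_eq_zero_of_dvd hE ⟨c • δ (E y), by rw [mul_smul_comm, ← hc]⟩)
  have := hf (δ + E) ⟨add_mem_LND h𝒜 hδ hE hδp hEe hy hδy hEy, y, by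
    rw [Derivation.add_apply, hδy, hEy, add_zero]⟩
  rw [Derivation.add_apply, hδf, zero_add] at this
  exact hEf this

variable [IsNoetherianRing B]

/-- If a homogeneous element is not killed by a locally nilpotent derivation `D`, then neither is
it by some locally nilpotent homogeneous part of `D`. For if `D_e f ≠ 0` only for `e` with a
positive multiple among the degrees of nonzero elements, then `D f / f` is integral over `B`, so its
powers have a common denominator. -/
theorem exists_homogeneousPart_mem_LND (h𝒜 : IsMultiplicityFree 𝒜) {D : Derivation K B B}
    (hD : D ∈ LND K B) {m : ι} {f : B} (hf : f ∈ 𝒜 m) (h0 : D f ≠ 0) :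
    ∃ e, homogeneousPart 𝒜 D e ∈ LND K B ∧ homogeneousPart 𝒜 D e f ≠ 0 := by
  classical
  by_contra! H
  have hf0 : f ≠ 0 := by
    rintro rfl
    exact h0 (map_zero D)
  apply h0
  obtain ⟨M, hM⟩ := exists_pow_dvd_pow_mul_sum_pow (DirectSum.decompose 𝒜 (D f)).support (f := f)
    (g := fun j => (DirectSum.decompose 𝒜 (D f) j : B)) (fun j hj => by
      have hj0 : GradedAlgebra.proj 𝒜 j (D f) ≠ 0 :=
        (GradedAlgebra.mem_support_iff 𝒜 _ _).1 hj
      have hgj : GradedAlgebra.proj 𝒜 j (D f) ∈ 𝒜 j := SetLike.coe_mem _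
      have hLND : homogeneousPart 𝒜 D (j - m) ∉ LND K B := fun hL => by
        refine hj0 ?_
        rw [← H _ hL, homogeneousPart_apply D _ hf, add_sub_cancel]
      obtain ⟨N, hN, hN0⟩ : ∃ N : ℕ, 0 < N ∧ 𝒜 (N • (j - m)) ≠ ⊥ := by
        by_contra! h
        exact hLND ((isHomogeneousOfDegree_homogeneousPart D _).mem_LND h)
      obtain ⟨w, hw, hw0⟩ := (Submodule.ne_bot_iff _).1 hN0
      obtain ⟨c, hc⟩ := h𝒜 (N • j) (GradedAlgebra.proj 𝒜 j (D f) ^ N)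
        (SetLike.pow_mem_graded N hgj) (w * f ^ N) (by
          have := SetLike.mul_mem_graded hw (SetLike.pow_mem_graded N hf)
          rwa [← nsmul_add, sub_add_cancel] at this)
        (mul_ne_zero hw0 (pow_ne_zero _ hf0))
      exact ⟨N, pow_dvd_pow_mul_pow hN (w := c • w) (by rw [smul_mul_assoc, ← hc]; rfl)⟩)
  rw [DirectSum.sum_support_decompose 𝒜 (D f)] at hM
  exact apply_eq_zero_of_pow_dvd hD M hM

/-- If some locally nilpotent derivation has a slice, then there is a homogeneous one with a
homogeneous slice. -/
theorem exists_homogeneous_slice (h𝒜 : IsMultiplicityFree 𝒜) {D : Derivation K B B}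
    (hD : D ∈ LND K B) {s : B} (hs : D s = 1) :
    ∃ (δ : Derivation K B B) (p : ι), δ ∈ LND K B ∧ IsHomogeneousOfDegree 𝒜 δ (-p) ∧
      ∃ y ∈ 𝒜 p, δ y = 1 := by
  classical
  have hscalar : ∀ c ∈ 𝒜 0, c ≠ 0 → ∃ a : K, a ≠ 0 ∧ c = algebraMap K B a := by
    intro c hc hc0
    obtain ⟨a, ha⟩ := h𝒜 0 c hc 1 (SetLike.one_mem_graded 𝒜) one_ne_zero
    refine ⟨a, ?_, by rw [ha, Algebra.algebraMap_eq_smul_one]⟩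
    rintro rfl
    exact hc0 (by simpa using ha)
  -- The component of degree zero of `D s = 1` is a sum of terms `D_{-p} s_p`.
  obtain ⟨p, f, hf, hpf⟩ : ∃ p, ∃ f ∈ 𝒜 p, GradedAlgebra.proj 𝒜 0 (D f) ≠ 0 := by
    by_contra! h
    have h1 : GradedAlgebra.proj 𝒜 0 (D s) = 0 := by
      rw [← DirectSum.sum_support_decompose 𝒜 s, map_sum, map_sum]
      exact Finset.sum_eq_zero fun p _ => h p _ (SetLike.coe_mem _)
    rw [hs, GradedAlgebra.proj_apply,
      DirectSum.decompose_of_mem_same 𝒜 (SetLike.one_mem_graded 𝒜)] at h1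
    exact one_ne_zero h1
  have hδf : homogeneousPart 𝒜 D (-p) f = GradedAlgebra.proj 𝒜 0 (D f) := by
    rw [homogeneousPart_apply D _ hf, add_neg_cancel]
  have hf0 : f ≠ 0 := by
    rintro rfl
    exact hpf (by rw [map_zero, map_zero])
  have hL : homogeneousPart 𝒜 D (-p) ∈ LND K B := by
    refine (isHomogeneousOfDegree_homogeneousPart D (-p)).mem_LND fun N hN => ?_
    rw [Submodule.eq_bot_iff]
    intro w hw
    by_contra hw0
    -- Otherwise `f` is a unit, and every locally nilpotent derivation kills the units.
    have hmem : w * f ^ N ∈ 𝒜 0 := by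
      have := SetLike.mul_mem_graded hw (SetLike.pow_mem_graded N hf)
      rwa [← nsmul_add, neg_add_cancel, nsmul_zero] at this
    obtain ⟨a, ha, hwa⟩ := hscalar _ hmem (mul_ne_zero hw0 (pow_ne_zero _ hf0))
    have hu : IsUnit f := by
      have : IsUnit (w * f ^ N) := by
        rw [hwa]
        exact (isUnit_iff_ne_zero.2 ha).map (algebraMap K B)
      exact (isUnit_pow_iff hN.ne').1 (isUnit_of_mul_isUnit_right this)
    apply hpf
    rw [apply_eq_zero_of_dvd hD hu.dvd, map_zero]
  obtain ⟨a, ha, hpa⟩ := hscalar _ (by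
    rw [GradedAlgebra.proj_apply]
    exact SetLike.coe_mem _) hpf
  refine ⟨homogeneousPart 𝒜 D (-p), p, hL, isHomogeneousOfDegree_homogeneousPart D (-p),
    a⁻¹ • f, (𝒜 p).smul_mem _ hf, ?_⟩
  rw [Derivation.map_smul, hδf, hpa, Algebra.smul_def, ← map_mul,
    inv_mul_cancel₀ ha, map_one]

end MultiplicityFree

/-! ### The grading of the coordinate algebra by the characters of the torus -/

section Characters

variable {K : Type*} [Field K] {n : ℕ}

theorem character_add (m m' : Fin n → ℤ) (t : Torus K n) :
    character (m + m') t = character m t * character m' t := by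
  simp [character, zpow_add, Finset.prod_mul_distrib]

/-- The character `χ^m`, as a homomorphism from the torus to the multiplicative monoid of `K`. -/
def characterHom (m : Fin n → ℤ) : Torus K n →* K where
  toFun t := (character m t : K)
  map_one' := by simp [character]
  map_mul' s t := by simp [character, mul_zpow, Finset.prod_mul_distrib]

theorem characterHom_injective [CharZero K] :
    Function.Injective (characterHom : (Fin n → ℤ) → (Torus K n →* K)) := by
  intro m m' h
  funext i
  have h2 : (2 : K) ≠ 0 := two_ne_zero
  have hv : ∀ m : Fin n → ℤ,
      characterHom m (Function.update 1 i (Units.mk0 2 h2)) = (2 : K) ^ m i := by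
    intro m
    change ((character m _ : Kˣ) : K) = _
    rw [character, Finset.prod_eq_single i]
    · simp
    · intro j _ hj
      simp [hj]
    · simp
  have h' : (2 : K) ^ m i = 2 ^ m' i := by rw [← hv, ← hv, h]
  have hQ : (2 : ℚ) ^ m i = 2 ^ m' i := by
    apply (Rat.cast_injective : Function.Injective ((↑) : ℚ → K))
    simpa using h'
  exact zpow_right_injective₀ (by norm_num) (by norm_num) hQ

/-- Linear independence of characters, with coefficients in a vector space. -/
theorem eq_zero_of_sum_character_smul [CharZero K] {V : Type*} [AddCommGroup V] [Module K V]
    (s : Finset (Fin n → ℤ)) (v : (Fin n → ℤ) → V)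
    (h : ∀ t : Torus K n, ∑ m ∈ s, (character m t : K) • v m = 0) : ∀ m ∈ s, v m = 0 := by
  intro m hm
  rw [← Module.forall_dual_apply_eq_zero_iff K]
  intro ℓ
  have hli := (linearIndependent_monoidHom (Torus K n) K).comp characterHom
    characterHom_injective
  refine linearIndependent_iff'.1 hli s (fun m => ℓ (v m)) ?_ m hm
  funext t
  have := congrArg ℓ (h t)
  rw [map_sum, map_zero] at this
  simpa [characterHom, mul_comm] using this

end Characters

namespace ToricStructure

variable {K : Type*} [Field K] {n : ℕ} {B : Type*} [CommRing B] [Algebra K B]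
  (X : ToricStructure K n B)

/-- Since the action is algebraic, the translates of a function `f` under the torus are finite
combinations of characters with coefficients in the coordinate algebra. -/
theorem exists_pullback_eq_sum (f : B) : ∃ v : (Fin n → ℤ) →₀ B, ∀ t : Torus K n,
    X.pullback t f = v.sum fun m b => (character m t : K) • b := by
  classical
  obtain ⟨φ, hφ⟩ := X.algebraic
  suffices H : ∀ z : B ⊗[K] TorusAlgebra K n, ∃ v : (Fin n → ℤ) →₀ B, ∀ t : Torus K n,
      Algebra.TensorProduct.rid K K B
        (Algebra.TensorProduct.map (AlgHom.id K B) (evalAt t) z) =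
      v.sum fun m b => (character m t : K) • b by
    obtain ⟨v, hv⟩ := H (φ f)
    exact ⟨v, fun t => by rw [hφ, hv]⟩
  have hadd : ∀ (v w : (Fin n → ℤ) →₀ B) (t : Torus K n),
      ((v + w).sum fun m b => (character m t : K) • b) =
        (v.sum fun m b => (character m t : K) • b) + w.sum fun m b => (character m t : K) • b :=
    fun v w t => Finsupp.sum_add_index' (by simp) (by simp)
  intro z
  induction z with
  | zero => exact ⟨0, fun t => by simp⟩
  | add x y hx hy =>
    obtain ⟨v, hv⟩ := hx
    obtain ⟨w, hw⟩ := hy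
    exact ⟨v + w, fun t => by rw [map_add, map_add, hv, hw, hadd]⟩
  | tmul b p =>
    induction p using AddMonoidAlgebra.induction_linear with
    | zero => exact ⟨0, fun t => by simp⟩
    | add p q hp hq =>
      obtain ⟨v, hv⟩ := hp
      obtain ⟨w, hw⟩ := hq
      exact ⟨v + w, fun t => by rw [TensorProduct.tmul_add, map_add, map_add, hv, hw, hadd]⟩
    | single m a =>
      refine ⟨Finsupp.single m (a • b), fun t => ?_⟩
      rw [Finsupp.sum_single_index (by simp), Algebra.TensorProduct.map_tmul, evalAt_single,
        Algebra.TensorProduct.rid_tmul, AlgHom.id_apply, smul_smul, mul_comm]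

theorem weightSpace_isInternal [CharZero K] : DirectSum.IsInternal X.weightSpace := by
  classical
  constructor
  · rw [injective_iff_map_eq_zero]
    intro x hx
    rw [DirectSum.coeAddMonoidHom_eq_dfinsuppSum] at hx
    have h := eq_zero_of_sum_character_smul x.support (fun m => (x m : B)) fun t => by
      have := congrArg (X.pullback t) hx
      rw [DFinsupp.sum, map_sum, map_zero] at this
      rw [← this]
      exact Finset.sum_congr rfl fun m _ => ((x m).2 t).symm
    ext m
    by_cases hm : m ∈ x.support
    · exact h m hm
    · rw [DFinsupp.notMem_support_iff.1 hm]
      rfl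
  · intro f
    obtain ⟨v, hv⟩ := X.exists_pullback_eq_sum f
    have hmem : ∀ m ∈ v.support, v m ∈ X.weightSpace m := by
      intro m hm s
      -- Compare the coefficients of `χ^m(t)` in `pullback (s * t) f = pullback s (pullback t f)`.
      rw [← sub_eq_zero]
      refine eq_zero_of_sum_character_smul (K := K) v.support
        (fun m => X.pullback s (v m) - (character m s : K) • v m) (fun t => ?_) m hm
      have h1 : X.pullback (s * t) f = X.pullback s (X.pullback t f) := by
        rw [map_mul]
        rfl
      rw [hv, hv, Finsupp.sum, Finsupp.sum, map_sum] at h1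
      simp only [smul_sub, Finset.sum_sub_distrib]
      rw [sub_eq_zero]
      refine Eq.trans (Finset.sum_congr rfl fun m _ => ?_) (h1.symm.trans
        (Finset.sum_congr rfl fun m _ => ?_))
      · rw [map_smul]
      · rw [smul_smul]
        congr 1
        exact (map_mul (characterHom m) s t).trans (mul_comm _ _)
    refine ⟨∑ m ∈ v.support.attach, DirectSum.of (fun m => X.weightSpace m) m.1
      ⟨v m.1, hmem m.1 m.2⟩, ?_⟩
    rw [map_sum]
    simp only [DirectSum.coeAddMonoidHom_of]
    rw [Finset.sum_attach v.support (fun m => v m)]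
    have := hv 1
    rw [map_one] at this
    rw [show f = (1 : B ≃ₐ[K] B) f from rfl, this, Finsupp.sum]
    exact Finset.sum_congr rfl fun m _ => by simp [character]

/-- The grading of the coordinate algebra by the character group of the torus. -/
instance gradedAlgebra [CharZero K] : GradedAlgebra X.weightSpace :=
  { X.weightSpace_isInternal.chooseDecomposition with
    one_mem := fun t => by simp [character]
    mul_mem := fun m m' a b ha hb t => by
      rw [map_mul, ha t, hb t, character_add, smul_mul_smul_comm, Units.val_mul] }

/-- A semi-invariant function is determined by its value at a point of the open orbit. -/
theorem isMultiplicityFree_weightSpace [IsAlgClosed K] [IsDomain B] [Algebra.FiniteType K B] :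
    IsMultiplicityFree X.weightSpace := by
  obtain ⟨x, hx⟩ := X.open_orbit
  obtain ⟨U, hU, hUx⟩ := isOpen_induced_iff.1 hx
  have hxU : x.toPrimeSpectrum ∈ U := by
    change x ∈ MaximalSpectrum.toPrimeSpectrum ⁻¹' U
    rw [hUx]
    refine ⟨1, ?_⟩
    rw [map_one]
    rfl
  obtain ⟨_, ⟨b, rfl⟩, hbx, hbU⟩ :=
    PrimeSpectrum.isTopologicalBasis_basic_opens.exists_subset_of_mem_open hxU hU
  have hb0 : b ≠ 0 := by
    rintro rfl
    exact hbx (zero_mem _)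
  -- A semi-invariant function that vanishes at `x` vanishes on the orbit of `x`.
  have hvan : ∀ m, ∀ f ∈ X.weightSpace m, f ∈ x.asIdeal → f = 0 := by
    intro m f hf hfx
    have hJ : b * f ∈ Ring.jacobson B := by
      rw [Ring.jacobson_eq_sInf_isMaximal, Ideal.mem_sInf]
      intro J hJ
      by_cases hbJ : b ∈ J
      · exact J.mul_mem_right _ hbJ
      · have hy : (⟨J, hJ⟩ : MaximalSpectrum B) ∈ MaximalSpectrum.toPrimeSpectrum ⁻¹' U :=
          hbU hbJ
        rw [hUx] at hy
        obtain ⟨t, ht⟩ := hy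
        refine J.mul_mem_left _ ?_
        rw [show J = _ from ht, Ideal.mem_comap]
        change X.pullback t f ∈ _
        rw [hf t, Algebra.smul_def]
        exact Ideal.mul_mem_left _ _ hfx
    have : IsJacobsonRing B := isJacobsonRing_of_finiteType (A := K)
    have hB : Ring.jacobson B = ⊥ := by
      have := IsJacobsonRing.out ‹IsJacobsonRing B› (Ideal.isPrime_bot (α := B)).isRadical
      rwa [Ideal.jacobson_bot] at this
    rw [hB] at hJ
    exact (mul_eq_zero.1 (Ideal.mem_bot.1 hJ)).resolve_left hb0
  intro m f hf g hg hg0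
  have := x.isMaximal
  let _ : Field (B ⧸ x.asIdeal) := Ideal.Quotient.field x.asIdeal
  have : Module.Finite K (B ⧸ x.asIdeal) := finite_of_finite_type_of_isJacobsonRing K _
  have hsurj : Function.Surjective (algebraMap K (B ⧸ x.asIdeal)) :=
    (IsAlgClosed.algebraMap_bijective_of_isIntegral (k := K)).2
  obtain ⟨α, hα⟩ := hsurj (Ideal.Quotient.mk x.asIdeal f)
  obtain ⟨β, hβ⟩ := hsurj (Ideal.Quotient.mk x.asIdeal g)
  have hβ0 : β ≠ 0 := by
    rintro rfl
    rw [map_zero] at hβ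
    exact hg0 (hvan m g hg (Ideal.Quotient.eq_zero_iff_mem.1 hβ.symm))
  refine ⟨α / β, ?_⟩
  rw [← sub_eq_zero]
  refine hvan m _ (sub_mem hf ((X.weightSpace m).smul_mem _ hg)) ?_
  rw [← Ideal.Quotient.eq_zero_iff_mem, map_sub, Algebra.smul_def, map_mul, ← hα, ← hβ,
    Ideal.Quotient.mk_algebraMap, ← map_mul, div_mul_cancel₀ _ hβ0, sub_self]

/-! ### The Makar-Limanov invariants are homogeneous subalgebras -/

/-- The conjugate of a derivation by an element of the torus. -/
def conj (D : Derivation K B B) (t : Torus K n) : Derivation K B B :=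
  Derivation.mk' ((X.pullback t⁻¹).toLinearMap ∘ₗ D.toLinearMap ∘ₗ (X.pullback t).toLinearMap)
    fun a b => by simp

theorem conj_apply (D : Derivation K B B) (t : Torus K n) (b : B) :
    X.conj D t b = X.pullback t⁻¹ (D (X.pullback t b)) :=
  rfl

theorem pullback_pullback_inv (t : Torus K n) (b : B) :
    X.pullback t (X.pullback t⁻¹ b) = b := by
  rw [← AlgEquiv.mul_apply, ← map_mul, mul_inv_cancel, map_one]
  rfl

theorem conj_mem_LNDStar {D : Derivation K B B} (hD : D ∈ LNDStar K B) (t : Torus K n) :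
    X.conj D t ∈ LNDStar K B := by
  have h : Function.Semiconj (X.pullback t) (X.conj D t) D := fun b => by
    rw [conj_apply, pullback_pullback_inv]
  obtain ⟨hD, s, hs⟩ := hD
  refine ⟨fun b => ?_, X.pullback t⁻¹ s, ?_⟩
  · obtain ⟨k, hk⟩ := hD (X.pullback t b)
    refine ⟨k, (X.pullback t).injective ?_⟩
    rw [map_zero]
    exact ((h.iterate_right k) b).trans hk
  · rw [conj_apply, pullback_pullback_inv, hs, map_one]

variable [CharZero K]

/-- The components of an element that is killed by all locally nilpotent derivations with a slice
are killed by them too, because the set of these derivations is stable under the torus. -/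
theorem apply_proj_eq_zero_of_LNDStar {f : B} (hf : ∀ D ∈ LNDStar K B, D f = 0)
    {D : Derivation K B B} (hD : D ∈ LNDStar K B) (m : Fin n → ℤ) :
    D (GradedAlgebra.proj X.weightSpace m f) = 0 := by
  classical
  by_cases hm : m ∈ (DirectSum.decompose X.weightSpace f).support
  · refine eq_zero_of_sum_character_smul (K := K) (DirectSum.decompose X.weightSpace f).support
      (fun m => D (GradedAlgebra.proj X.weightSpace m f)) (fun t => ?_) m hm
    have h := hf _ (X.conj_mem_LNDStar hD t)
    rw [conj_apply, map_eq_zero_iff _ (X.pullback t⁻¹).injective] at h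
    rw [← h]
    conv_rhs => rw [← DirectSum.sum_support_decompose X.weightSpace f, map_sum, map_sum]
    refine Finset.sum_congr rfl fun m _ => ?_
    rw [(DirectSum.decompose X.weightSpace f m).2 t, Derivation.map_smul]
    rfl
  · rw [GradedAlgebra.mem_support_iff, not_not] at hm
    rw [hm, map_zero]

/-- The components of an element that is killed by a homogeneous derivation are killed by it too. -/
theorem apply_proj_eq_zero {f : B} {D : Derivation K B B} (hD : X.IsHomogeneous D)
    (hf : D f = 0) (m : Fin n → ℤ) : D (GradedAlgebra.proj X.weightSpace m f) = 0 := by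
  classical
  obtain ⟨e, he⟩ := hD
  have h : ∀ g : B, GradedAlgebra.proj X.weightSpace (m + e) (D g) =
      D (GradedAlgebra.proj X.weightSpace m g) := by
    intro g
    induction g using DirectSum.Decomposition.inductionOn X.weightSpace with
    | zero => simp
    | add a b ha hb => simp only [map_add, ha, hb]
    | @homogeneous p a =>
      rw [GradedAlgebra.proj_apply, GradedAlgebra.proj_apply]
      by_cases hpm : p = m
      · subst hpm
        rw [DirectSum.decompose_of_mem_same _ (he _ _ a.2),
          DirectSum.decompose_of_mem_same _ a.2]
      · rw [DirectSum.decompose_of_mem_ne _ (he _ _ a.2) (fun h => hpm (add_right_cancel h)),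
          DirectSum.decompose_of_mem_ne _ a.2 hpm, map_zero]
  rw [← h, hf, map_zero]

end ToricStructure

theorem mem_biInf_ker {K B : Type*} [Field K] [CommRing B] [Algebra K B]
    {S : Set (Derivation K B B)} {f : B} : f ∈ ⨅ D ∈ S, ker D ↔ ∀ D ∈ S, D f = 0 := by
  simp only [Algebra.mem_iInf]
  rfl

namespace ToricStructure

variable {K : Type*} [Field K] [IsAlgClosed K] [CharZero K] {B : Type*} [CommRing B] [IsDomain B]
  [Algebra K B] [Algebra.FiniteType K B] {n : ℕ} (X : ToricStructure K n B)

theorem MLh_eq_ML : X.MLh = ML K B := by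
  have := Algebra.FiniteType.isNoetherianRing K B
  refine le_antisymm (fun f hf => ?_) (fun f hf => ?_)
  · rw [MLh, mem_biInf_ker] at hf
    rw [ML, mem_biInf_ker]
    intro D hD
    by_contra h
    obtain ⟨m, hm⟩ : ∃ m, D (GradedAlgebra.proj X.weightSpace m f) ≠ 0 := by
      classical
      by_contra! h'
      apply h
      rw [← DirectSum.sum_support_decompose X.weightSpace f, map_sum]
      exact Finset.sum_eq_zero fun m _ => h' m
    obtain ⟨e, he, he0⟩ := exists_homogeneousPart_mem_LND X.isMultiplicityFree_weightSpace hD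
      (show GradedAlgebra.proj X.weightSpace m f ∈ X.weightSpace m from SetLike.coe_mem _) hm
    have hh : X.IsHomogeneous (homogeneousPart X.weightSpace D e) :=
      ⟨e, isHomogeneousOfDegree_homogeneousPart D e⟩
    exact he0 (X.apply_proj_eq_zero hh (hf _ ⟨he, hh⟩) m)
  · rw [ML, mem_biInf_ker] at hf
    rw [MLh, mem_biInf_ker]
    exact fun D hD => hf D hD.1

theorem MLStar_le_MLh (h : (LNDStar K B).Nonempty) : MLStar K B ≤ X.MLh := by
  classical
  have := Algebra.FiniteType.isNoetherianRing K B
  obtain ⟨D₀, hD₀, s, hs⟩ := h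
  obtain ⟨δ, p, hδ, hδp, y, hy, hδy⟩ :=
    exists_homogeneous_slice X.isMultiplicityFree_weightSpace hD₀ hs
  intro f hf
  rw [MLStar, mem_biInf_ker] at hf
  rw [MLh, mem_biInf_ker]
  rintro E ⟨hE, e, hEe⟩
  rw [← DirectSum.sum_support_decompose X.weightSpace f, map_sum]
  exact Finset.sum_eq_zero fun m _ =>
    apply_eq_zero_of_mem_MLStar X.isMultiplicityFree_weightSpace hδ hδp hy hδy
      (SetLike.coe_mem _) (fun D hD => X.apply_proj_eq_zero_of_LNDStar hf hD m) hE hEe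

end ToricStructure

end AffineToric

end

theorem theorem1p1 {K : Type*} [Field K] [IsAlgClosed K] [CharZero K]
    {B : Type*} [CommRing B] [IsDomain B] [Algebra K B] [Algebra.FiniteType K B]
    {n : ℕ} (X : AffineToric.ToricStructure K n B) :
    X.MLh = AffineToric.ML K B ∧
      ((AffineToric.LNDStar K B).Nonempty →
        X.MLh = AffineToric.ML K B ∧ AffineToric.ML K B = AffineToric.MLStar K B) := by
  refine ⟨X.MLh_eq_ML, fun h => ⟨X.MLh_eq_ML, le_antisymm (fun f hf => ?_) ?_⟩⟩
  · rw [AffineToric.ML, AffineToric.mem_biInf_ker] at hf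
    rw [AffineToric.MLStar, AffineToric.mem_biInf_ker]
    exact fun D hD => hf D hD.1
  · rw [← X.MLh_eq_ML]
    exact X.MLStar_le_MLh h
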